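/- For a partition $\pi$ of $[n]=\{1,\dots,n\}$, say that two blocks $A,B$ of $\pi$ overlap if $\min A<\min B<\max A<\max B$, and let $\mathrm{ov}(\pi)$ be the number of pairs of overlapping blocks of $\pi$. Let $B_n$ be the Bell numbers and $S_{n,k}$ the Stirling numbers of the second kind. Let $\mu_n$ be the average of $\mathrm{ov}$ over all partitions of $[n]$ and, for $1\le k\le n$, let $\mu_{n,k}$ be its average over all partitions of $[n]$ into exactly $k$ blocks (in both cases each partition is equally likely). (1) For every $n\ge 1$, $$\mu_n=\frac14\frac{B_{n+2}}{B_n}+\frac34\frac{B_{n+1}}{B_n}-\Bigl(n+\frac54\Bigr)-\frac n2\,\frac{B_{n-1}}{B_n},$$ and, as $n\to\infty$, $$\mu_n=\frac14\Bigl(\frac{n}{\log n}\Bigr)^2\Bigl(1+2\,\frac{\log\log n}{\log n}\,(1+o(1))\Bigr).$$ (2) For all $n\ge k\ge 1$, $$\mu_{n,k}=\frac12\binom k2+\frac12\,n(k-1)\frac{S_{n-1,k-1}}{S_{n,k}}-\frac32\,(n+1-k)\frac{S_{n,k-1}}{S_{n,k}},$$ and, for every fixed $k\ge1$, $$\mu_{n,k}=\frac12\binom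 k2+o(1)\qquad\text{as } n\to\infty.$$ -/

import Mathlib

open Filter Topology

/-- Two finite sets `A`, `B` of positive integers overlap, in this order, if they are nonempty and
`min A < min B < max A < max B`. -/
def Overlap (A B : Finset ℕ) : Prop :=
  ∃ (hA : A.Nonempty) (hB : B.Nonempty),
    A.min' hA < B.min' hB ∧ B.min' hB < A.max' hA ∧ A.max' hA < B.max' hB

open Classical in
/-- The number of overlappings of a set partition `π`. A pair of overlapping blocks is counted once,
since `Overlap A B` and `Overlap B A` exclude each other. -/
noncomputable def overlappings {s : Finset ℕ} (π : Finpartition s) : ℕ :=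
  ((π.parts ×ˢ π.parts).filter fun p => Overlap p.1 p.2).card

/-- The set of all partitions of `[n] = {1, …, n}`. -/
def setPartitions (n : ℕ) : Finset (Finpartition (Finset.Icc 1 n)) :=
  Finset.univ

/-- The set of all partitions of `[n]` into exactly `k` blocks. -/
def blockPartitions (n k : ℕ) : Finset (Finpartition (Finset.Icc 1 n)) :=
  (setPartitions n).filter fun π => π.parts.card = k

/-- The average number of overlappings in a uniformly random partition of `[n]`. -/
noncomputable def meanOverlappings (n : ℕ) : ℝ :=
  (∑ π ∈ setPartitions n, (overlappings π : ℝ)) / ((setPartitions n).card : ℝ)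

/-- The average number of overlappings in a uniformly random partition of `[n]` into `k` blocks
(there is such a partition for `1 ≤ k ≤ n`). -/
noncomputable def meanOverlappingsBlocks (n k : ℕ) : ℝ :=
  (∑ π ∈ blockPartitions n k, (overlappings π : ℝ)) / ((blockPartitions n k).card : ℝ)

/-! Every partition of `[n+1]` arises once from a partition of `[n]`, by adding `n+1` as a singleton
or to a block. The enlarged block ends last, so it is never the left member of an overlapping pair,
and `A` overlaps `C ∪ {n+1}` exactly when `C` starts strictly inside `A`. Of two distinct blocks,
the later-starting one begins either inside the other or to the right of it; hence such starts
number `k(k-1)/2` minus the pairs of separated blocks. The total of separated pairs obeys a closed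
recursion, solved by `(n-k) S(n,k)` for `k+1` blocks. Feeding this into the recursion for overlaps
gives the formula for fixed `k` by induction (`blockTotal_overlapWeight`).

Summing over `k` needs only the Stirling moments of degree at most two, which are Bell numbers. For
fixed `k`, both correction terms are `O(n (k/(k-1))^(-n))` when `k > 1`, and vanish when `k = 1`.

For the Bell asymptotics, put `a = B_{N+1}/B_N`. Jensen's inequality on the Dobinski series `∑
m^N/m!` gives `(1+1/a)^N ≤ a` and `a (1-1/a)^N ≤ 1`, hence `|N - a log a| ≤ log a`
(`abs_sub_bellRatio_mul_log_le`). Inverting this gives `a log N / N - 1 ~ log log N / log N`. The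
main term of the mean is a quarter of a product of two such ratios, which produces the factor 2; the
remaining terms are of order `n`. -/

/-! ### Partitions of a set with one more element -/

theorem grow_parts_subset {s : Finset ℕ} (π : Finpartition s) {a : ℕ} {C : Finset ℕ}
    (hC : C ∈ insert ∅ π.parts) :
    ∀ p ∈ insert (insert a C) (π.parts.erase C), p ⊆ insert a s := by
  have hsub : ∀ p ∈ π.parts, p ⊆ s := fun p hp => π.subset hp
  grind

theorem grow_parts_existsUnique {s : Finset ℕ} (π : Finpartition s) {a : ℕ} (ha : a ∉ s)
    {C : Finset ℕ} (hC : C ∈ insert ∅ π.parts) :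
    ∀ x ∈ insert a s, ∃! t ∈ insert (insert a C) (π.parts.erase C), x ∈ t := by
  have hsub : ∀ p ∈ π.parts, p ⊆ s := fun p hp => π.subset hp
  intro x hx
  by_cases hxa : x = a
  · subst hxa
    refine ⟨insert x C, by simp, ?_⟩
    rintro t ⟨ht, hxt⟩
    grind
  · have hxs : x ∈ s := by grind
    obtain ⟨t, ht, hxt⟩ := π.exists_mem hxs
    have huniq : ∀ u ∈ π.parts, x ∈ u → u = t := fun u hu hxu => π.eq_of_mem_parts hu ht hxu hxt
    by_cases htC : t = C
    · refine ⟨insert a C, ⟨by simp, by grind⟩, ?_⟩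
      rintro u ⟨hu, hxu⟩
      grind
    · refine ⟨t, ⟨by grind, hxt⟩, ?_⟩
      rintro u ⟨hu, hxu⟩
      grind

/-- Add the new element `a` to the block `C` of `π`, or as a new block if `C = ∅`. -/
def growPartition {s : Finset ℕ} (π : Finpartition s) {a : ℕ} (ha : a ∉ s) {C : Finset ℕ}
    (hC : C ∈ insert ∅ π.parts) : Finpartition (insert a s) :=
  Finpartition.ofExistsUnique (insert (insert a C) (π.parts.erase C))
    (grow_parts_subset π hC) (grow_parts_existsUnique π ha hC) (by
      have := π.empty_notMem_parts
      have h : (∅ : Finset ℕ) ≠ insert a C := (Finset.insert_nonempty a C).ne_empty.symm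
      grind)

/-- Deleting `a` inverts the growth, the empty set standing for the case where `a` is a singleton.
The statistic `f` depends on the parts alone, which avoids transport between partition types; `t` is
free because `Icc 1 (n+1)` is not syntactically an `insert`. -/
theorem sum_finpartition_insert {M : Type*} [AddCommMonoid M] {s t : Finset ℕ} {a : ℕ}
    (ha : a ∉ s) (ht : t = insert a s) (f : Finset (Finset ℕ) → M) :
    ∑ ρ : Finpartition t, f ρ.parts =
      ∑ π : Finpartition s, (f (insert {a} π.parts) +
        ∑ C ∈ π.parts, f (insert (insert a C) (π.parts.erase C))) := by
  subst ht
  have hsplit : ∀ π : Finpartition s, f (insert {a} π.parts) +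
      ∑ C ∈ π.parts, f (insert (insert a C) (π.parts.erase C)) =
      ∑ C ∈ insert ∅ π.parts, f (insert (insert a C) (π.parts.erase C)) := by
    intro π
    rw [Finset.sum_insert π.empty_notMem_parts, Finset.erase_eq_of_notMem π.empty_notMem_parts]
    rfl
  simp_rw [hsplit]
  rw [Finset.sum_sigma']
  symm
  refine Finset.sum_bij
    (fun x hx => growPartition x.1 ha (C := x.2) (Finset.mem_sigma.1 hx).2)
    (fun _ _ => Finset.mem_univ _) ?_ ?_ (fun _ _ => rfl)
  · rintro ⟨π, C⟩ h₁ ⟨ρ, D⟩ h₂ h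
    have hparts : insert (insert a C) (π.parts.erase C) =
        insert (insert a D) (ρ.parts.erase D) := congrArg Finpartition.parts h
    have hC := (Finset.mem_sigma.1 h₁).2
    have hD := (Finset.mem_sigma.1 h₂).2
    simp only at hC hD
    have hπ : ∀ p ∈ π.parts, a ∉ p := fun p hp hap => ha (π.subset hp hap)
    have hρ : ∀ p ∈ ρ.parts, a ∉ p := fun p hp hap => ha (ρ.subset hp hap)
    have hπ0 := π.empty_notMem_parts
    have hρ0 := ρ.empty_notMem_parts
    have haC : a ∉ C := by grind
    have haD : a ∉ D := by grind
    -- The block containing `a` determines `C`, since all other blocks lie in `s`.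
    have hCD : C = D := by
      have h1 : insert a C ∈ insert (insert a D) (ρ.parts.erase D) := by
        rw [← hparts]; simp
      have h2 : insert a C = insert a D := by
        rcases Finset.mem_insert.1 h1 with h | h
        · exact h
        · exact absurd (Finset.mem_insert_self a C) (hρ _ (Finset.mem_of_mem_erase h))
      rw [← Finset.erase_insert haC, h2, Finset.erase_insert haD]
    subst hCD
    have herase : π.parts.erase C = ρ.parts.erase C := by
      have h1 : insert a C ∉ π.parts.erase C := by grind
      have h2 : insert a C ∉ ρ.parts.erase C := by grind
      rw [← Finset.erase_insert h1, hparts, Finset.erase_insert h2]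
    have hπρ : π.parts = ρ.parts := by
      rcases Finset.mem_insert.1 hC with h0 | h0
      · subst h0
        rwa [Finset.erase_eq_of_notMem hπ0, Finset.erase_eq_of_notMem hρ0] at herase
      · rcases Finset.mem_insert.1 hD with h3 | h3
        · subst h3; exact absurd h0 hπ0
        · rw [← Finset.insert_erase h0, herase, Finset.insert_erase h3]
    obtain rfl : π = ρ := Finpartition.ext hπρ
    rfl
  · intro ρ _
    have hs : insert a s \ {a} = s := by
      rw [Finset.insert_sdiff_of_mem _ (Finset.mem_singleton_self a),
        Finset.sdiff_singleton_eq_erase, Finset.erase_eq_of_notMem ha]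
    set π : Finpartition s := (ρ.avoid {a}).copy hs with hπ
    set X := ρ.part a with hX
    have hXmem : X ∈ ρ.parts := ρ.part_mem.2 (Finset.mem_insert_self a s)
    have haX : a ∈ X := ρ.mem_part_self.2 (Finset.mem_insert_self a s)
    have hXuniq : ∀ u ∈ ρ.parts, a ∈ u → u = X := fun u hu hau =>
      ρ.eq_of_mem_parts hu hXmem hau haX
    have hρ0 := ρ.empty_notMem_parts
    have hmem : ∀ c, c ∈ π.parts ↔ (c ≠ ∅ ∧ c = X.erase a) ∨ (c ∈ ρ.parts ∧ c ≠ X) := by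
      intro c
      have : c ∈ π.parts ↔ ∃ d ∈ ρ.parts, ¬d ≤ {a} ∧ d \ {a} = c := ρ.mem_avoid
      rw [this]
      constructor
      · rintro ⟨d, hd, hda, rfl⟩
        by_cases hdX : d = X
        · left
          rw [Finset.sdiff_singleton_eq_erase]
          refine ⟨?_, by rw [hdX]⟩
          intro h0
          exact hda (by
            have := (Finset.sdiff_eq_empty_iff_subset (s := d) (t := {a})).1
              (by rw [Finset.sdiff_singleton_eq_erase]; exact h0)
            exact this)
        · right
          have : a ∉ d := fun h => hdX (hXuniq d hd h)
          rw [Finset.sdiff_singleton_eq_erase, Finset.erase_eq_of_notMem this]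
          exact ⟨hd, hdX⟩
      · rintro (⟨h0, rfl⟩ | ⟨hc, hcX⟩)
        · refine ⟨X, hXmem, ?_, Finset.sdiff_singleton_eq_erase _ _⟩
          intro hle
          apply h0
          rw [← Finset.sdiff_singleton_eq_erase]
          exact Finset.sdiff_eq_empty_iff_subset.2 hle
        · have hac : a ∉ c := fun h => hcX (hXuniq c hc h)
          refine ⟨c, hc, ?_, by
            rw [Finset.sdiff_singleton_eq_erase, Finset.erase_eq_of_notMem hac]⟩
          intro hle
          have hle' : c ⊆ {a} := hle
          rcases Finset.subset_singleton_iff.1 hle' with h | h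
          · exact hρ0 (h ▸ hc)
          · exact hac (by rw [h]; simp)
    have hC : X.erase a ∈ insert ∅ π.parts := by
      rw [Finset.mem_insert, hmem]
      by_cases h : X.erase a = ∅
      · exact Or.inl h
      · exact Or.inr (Or.inl ⟨h, rfl⟩)
    refine ⟨⟨π, X.erase a⟩, Finset.mem_sigma.2 ⟨Finset.mem_univ _, hC⟩, ?_⟩
    apply Finpartition.ext
    change insert (insert a (X.erase a)) (π.parts.erase (X.erase a)) = ρ.parts
    rw [Finset.insert_erase haX]
    ext c
    rw [Finset.mem_insert, Finset.mem_erase, hmem]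
    constructor
    · rintro (rfl | ⟨h1, h2 | h2⟩)
      · exact hXmem
      · exact absurd h2.2 h1
      · exact h2.1
    · intro hc
      by_cases hcX : c = X
      · exact Or.inl hcX
      · refine Or.inr ⟨?_, Or.inr ⟨hc, hcX⟩⟩
        rintro rfl
        have hne : (X.erase a).Nonempty := ρ.nonempty_of_mem_parts hc
        obtain ⟨y, hy⟩ := hne
        exact hcX (ρ.eq_of_mem_parts hc hXmem hy (Finset.mem_of_mem_erase hy))

/-! ### Statistics of pairs of blocks -/

/-- The sum of a weight over all ordered pairs of blocks. -/
def pairSum (w : Finset ℕ → Finset ℕ → ℝ) (P : Finset (Finset ℕ)) : ℝ :=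
  ∑ A ∈ P, ∑ B ∈ P, w A B

theorem pairSum_insert (w : Finset ℕ → Finset ℕ → ℝ) {Q : Finset (Finset ℕ)} {C : Finset ℕ}
    (hC : C ∉ Q) (hw : w C C = 0) :
    pairSum w (insert C Q) = pairSum w Q + ∑ A ∈ Q, (w A C + w C A) := by
  unfold pairSum
  rw [Finset.sum_insert hC, Finset.sum_insert hC, hw, zero_add]
  simp_rw [Finset.sum_insert hC, Finset.sum_add_distrib]
  ring

theorem pairSum_erase (w : Finset ℕ → Finset ℕ → ℝ) {P : Finset (Finset ℕ)} {C : Finset ℕ}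
    (hC : C ∈ P) (hw : w C C = 0) :
    pairSum w (P.erase C) = pairSum w P - ∑ A ∈ P, (w A C + w C A) := by
  have h := pairSum_insert w (Finset.notMem_erase C P) hw
  rw [Finset.insert_erase hC] at h
  have h2 := Finset.add_sum_erase P (fun A => w A C + w C A) hC
  simp only [hw] at h2
  linarith

/-- A pair of distinct blocks survives the removal of `C` unless `C` is one of its two members. -/
theorem sum_pairSum_erase (w : Finset ℕ → Finset ℕ → ℝ) {P : Finset (Finset ℕ)}
    (hw : ∀ C ∈ P, w C C = 0) :
    ∑ C ∈ P, pairSum w (P.erase C) = ((P.card : ℝ) - 2) * pairSum w P := by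
  rw [Finset.sum_congr rfl (fun C hC => pairSum_erase w hC (hw C hC)), Finset.sum_sub_distrib,
    Finset.sum_const, nsmul_eq_mul]
  simp_rw [Finset.sum_add_distrib]
  have h1 : ∑ C ∈ P, ∑ A ∈ P, w A C = pairSum w P := Finset.sum_comm
  have h2 : ∑ C ∈ P, ∑ A ∈ P, w C A = pairSum w P := rfl
  rw [h1, h2]
  ring

/-- The least element of a finite set. -/
noncomputable def lo (A : Finset ℕ) : ℕ := sInf (A : Set ℕ)

/-- The greatest element of a finite set. -/
noncomputable def hi (A : Finset ℕ) : ℕ := sSup (A : Set ℕ)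

theorem isLeast_lo {A : Finset ℕ} (hA : A.Nonempty) : IsLeast (A : Set ℕ) (lo A) := by
  have h := A.isLeast_min' hA
  unfold lo
  rwa [h.csInf_eq]

theorem isGreatest_hi {A : Finset ℕ} (hA : A.Nonempty) : IsGreatest (A : Set ℕ) (hi A) := by
  have h := A.isGreatest_max' hA
  unfold hi
  rwa [h.csSup_eq]

theorem lo_insert {A : Finset ℕ} (hA : A.Nonempty) {a : ℕ} (ha : ∀ x ∈ A, x < a) :
    lo (insert a A) = lo A := by
  refine IsLeast.unique (isLeast_lo (Finset.insert_nonempty a A)) ⟨?_, ?_⟩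
  · exact Finset.mem_coe.2 (Finset.mem_insert_of_mem (isLeast_lo hA).1)
  · intro x hx
    rcases Finset.mem_insert.1 (Finset.mem_coe.1 hx) with rfl | h
    · exact (ha _ (isLeast_lo hA).1).le
    · exact (isLeast_lo hA).2 h

theorem hi_insert {A : Finset ℕ} {a : ℕ} (ha : ∀ x ∈ A, x < a) : hi (insert a A) = a := by
  refine IsGreatest.unique (isGreatest_hi (Finset.insert_nonempty a A)) ⟨by simp, ?_⟩
  intro x hx
  rcases Finset.mem_insert.1 (Finset.mem_coe.1 hx) with rfl | h
  · exact le_rfl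
  · exact (ha _ h).le

theorem lo_singleton (a : ℕ) : lo {a} = a := by simp [lo]

theorem hi_singleton (a : ℕ) : hi {a} = a := by simp [hi]

theorem lo_le_hi {A : Finset ℕ} (hA : A.Nonempty) : lo A ≤ hi A :=
  (isLeast_lo hA).2 (isGreatest_hi hA).1

open Classical in
/-- The indicator that `A` and `B` overlap. -/
noncomputable def overlapWeight (A B : Finset ℕ) : ℝ :=
  if lo A < lo B ∧ lo B < hi A ∧ hi A < hi B then 1 else 0

open Classical in
/-- The indicator that `A` lies entirely to the left of `B`. -/
noncomputable def leftWeight (A B : Finset ℕ) : ℝ := if hi A < lo B then 1 else 0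

open Classical in
/-- The indicator that `B` starts strictly between the ends of `A`. -/
noncomputable def startWeight (A B : Finset ℕ) : ℝ := if lo A < lo B ∧ lo B < hi A then 1 else 0

theorem overlapWeight_self (A : Finset ℕ) : overlapWeight A A = 0 := by simp [overlapWeight]

theorem startWeight_self (A : Finset ℕ) : startWeight A A = 0 := by simp [startWeight]

theorem leftWeight_self {A : Finset ℕ} (hA : A.Nonempty) : leftWeight A A = 0 := by
  simp [leftWeight, lo_le_hi hA]

/-! ### Effect of adding `n+1` on the pair statistics -/

section Grow

variable {n : ℕ} (π : Finpartition (Finset.Icc 1 n))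

theorem lt_of_mem_part {A : Finset ℕ} (hA : A ∈ π.parts) : ∀ x ∈ A, x < n + 1 := by
  intro x hx
  have := Finset.mem_Icc.1 (π.subset hA hx)
  omega

theorem hi_lt {A : Finset ℕ} (hA : A ∈ π.parts) : hi A < n + 1 :=
  lt_of_mem_part π hA _ (isGreatest_hi (π.nonempty_of_mem_parts hA)).1

theorem lo_lt {A : Finset ℕ} (hA : A ∈ π.parts) : lo A < n + 1 :=
  lt_of_mem_part π hA _ (isLeast_lo (π.nonempty_of_mem_parts hA)).1

theorem insert_notMem_parts (C : Finset ℕ) : insert (n + 1) C ∉ π.parts := fun h =>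
  lt_irrefl _ (lt_of_mem_part π h _ (Finset.mem_insert_self _ _))

theorem singleton_notMem_parts : {n + 1} ∉ π.parts := insert_notMem_parts π ∅

theorem insert_notMem_erase (C : Finset ℕ) : insert (n + 1) C ∉ π.parts.erase C := fun h =>
  insert_notMem_parts π C (Finset.mem_of_mem_erase h)

theorem lo_insert_part {C : Finset ℕ} (hC : C ∈ π.parts) : lo (insert (n + 1) C) = lo C :=
  lo_insert (π.nonempty_of_mem_parts hC) (lt_of_mem_part π hC)

theorem hi_insert_part {C : Finset ℕ} (hC : C ∈ π.parts) : hi (insert (n + 1) C) = n + 1 :=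
  hi_insert (lt_of_mem_part π hC)

/-- Pairs not involving `C` contribute the factor `card - 2`. The enlarged block counts only as
second member, where its weight is a statistic `v` of the old partition. -/
theorem pairSum_grow (w v : Finset ℕ → Finset ℕ → ℝ)
    (hw : ∀ C : Finset ℕ, C.Nonempty → w C C = 0) (hv : ∀ C : Finset ℕ, C.Nonempty → v C C = 0)
    (hwv : ∀ A ∈ π.parts, ∀ C ∈ π.parts, w A (insert (n + 1) C) = v A C)
    (hw0 : ∀ A ∈ π.parts, ∀ C ∈ π.parts, w (insert (n + 1) C) A = 0) :
    ∑ C ∈ π.parts, pairSum w (insert (insert (n + 1) C) (π.parts.erase C)) =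
      ((π.parts.card : ℝ) - 2) * pairSum w π.parts + pairSum v π.parts := by
  have hstep : ∀ C ∈ π.parts, pairSum w (insert (insert (n + 1) C) (π.parts.erase C)) =
      pairSum w (π.parts.erase C) + ∑ A ∈ π.parts, v A C := by
    intro C hC
    rw [pairSum_insert w (insert_notMem_erase π C) (hw _ (Finset.insert_nonempty _ _)),
      ← Finset.add_sum_erase _ _ hC, hv C (π.nonempty_of_mem_parts hC), zero_add]
    congr 1
    refine Finset.sum_congr rfl fun A hA => ?_
    have hA' := Finset.mem_of_mem_erase hA
    rw [hwv A hA' C hC, hw0 A hA' C hC, add_zero]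
  rw [Finset.sum_congr rfl hstep, Finset.sum_add_distrib,
    sum_pairSum_erase w fun C hC => hw C (π.nonempty_of_mem_parts hC)]
  congr 1
  exact Finset.sum_comm

theorem sum_overlapWeight_grow :
    ∑ C ∈ π.parts, pairSum overlapWeight (insert (insert (n + 1) C) (π.parts.erase C)) =
      ((π.parts.card : ℝ) - 2) * pairSum overlapWeight π.parts +
        pairSum startWeight π.parts := by
  refine pairSum_grow π _ _ (fun C _ => overlapWeight_self C) (fun C _ => startWeight_self C) ?_ ?_
  · intro A hA C hC
    simp only [overlapWeight, startWeight, lo_insert_part π hC, hi_insert_part π hC, hi_lt π hA,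
      and_true]
  · intro A hA C hC
    have := hi_lt π hA
    simp only [overlapWeight, hi_insert_part π hC]
    rw [if_neg]
    omega

theorem sum_leftWeight_grow :
    ∑ C ∈ π.parts, pairSum leftWeight (insert (insert (n + 1) C) (π.parts.erase C)) =
      ((π.parts.card : ℝ) - 1) * pairSum leftWeight π.parts := by
  rw [pairSum_grow π leftWeight leftWeight (fun C hC => leftWeight_self hC)
    (fun C hC => leftWeight_self hC)]
  · ring
  · intro A hA C hC
    simp only [leftWeight, lo_insert_part π hC]
  · intro A hA C hC
    have := lo_lt π hA
    simp only [leftWeight, hi_insert_part π hC]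
    rw [if_neg]
    omega

theorem overlapWeight_grow_singleton :
    pairSum overlapWeight (insert {n + 1} π.parts) = pairSum overlapWeight π.parts := by
  rw [pairSum_insert _ (singleton_notMem_parts π) (overlapWeight_self _)]
  rw [Finset.sum_eq_zero, add_zero]
  intro A hA
  have h1 := hi_lt π hA
  have h2 := lo_lt π hA
  simp only [overlapWeight, lo_singleton, hi_singleton]
  rw [if_neg (by omega), if_neg (by omega), add_zero]

theorem leftWeight_grow_singleton :
    pairSum leftWeight (insert {n + 1} π.parts) =
      pairSum leftWeight π.parts + π.parts.card := by
  rw [pairSum_insert _ (singleton_notMem_parts π) (leftWeight_self (Finset.singleton_nonempty _))]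
  congr 1
  rw [Finset.card_eq_sum_ones, Nat.cast_sum]
  refine Finset.sum_congr rfl fun A hA => ?_
  have h1 := hi_lt π hA
  have h2 := lo_lt π hA
  simp only [leftWeight, lo_singleton, hi_singleton]
  rw [if_pos (by omega), if_neg (by omega), add_zero, Nat.cast_one]

/-- For two distinct blocks, exactly one of the four indicators holds: disjointness makes the minima
differ, and the later block starts either inside or after the earlier one. -/
theorem startWeight_add_leftWeight :
    pairSum startWeight π.parts + pairSum leftWeight π.parts =
      (π.parts.card : ℝ) * ((π.parts.card : ℝ) - 1) / 2 := by
  have key : ∀ A ∈ π.parts, ∀ B ∈ π.parts,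
      (startWeight A B + leftWeight A B) + (startWeight B A + leftWeight B A) =
        if A = B then 0 else 1 := by
    intro A hA B hB
    have hAn := π.nonempty_of_mem_parts hA
    have hBn := π.nonempty_of_mem_parts hB
    by_cases hAB : A = B
    · subst hAB
      simp [startWeight_self, leftWeight_self hAn]
    · rw [if_neg hAB]
      have hdisj : ∀ x, x ∈ A → x ∉ B := fun x hxA hxB => hAB (π.eq_of_mem_parts hA hB hxA hxB)
      have lA : lo A ∈ A := (isLeast_lo hAn).1
      have lB : lo B ∈ B := (isLeast_lo hBn).1
      have uA : hi A ∈ A := (isGreatest_hi hAn).1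
      have uB : hi B ∈ B := (isGreatest_hi hBn).1
      have n1 : lo A ≠ lo B := fun h => hdisj _ lA (h ▸ lB)
      have n2 : hi A ≠ lo B := fun h => hdisj _ uA (h ▸ lB)
      have n3 : lo A ≠ hi B := fun h => hdisj _ lA (h ▸ uB)
      have l1 := lo_le_hi hAn
      have l2 := lo_le_hi hBn
      unfold startWeight leftWeight
      split_ifs <;> first | omega | norm_num
  have h2 : pairSum startWeight π.parts + pairSum leftWeight π.parts =
      ∑ A ∈ π.parts, ∑ B ∈ π.parts, (startWeight A B + leftWeight A B) := by
    simp only [pairSum, Finset.sum_add_distrib]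
  have h3 : ∑ A ∈ π.parts, ∑ B ∈ π.parts, (startWeight A B + leftWeight A B) =
      ∑ A ∈ π.parts, ∑ B ∈ π.parts, (startWeight B A + leftWeight B A) := Finset.sum_comm
  have h4 : ∑ A ∈ π.parts, ∑ B ∈ π.parts, (startWeight A B + leftWeight A B) +
      ∑ A ∈ π.parts, ∑ B ∈ π.parts, (startWeight B A + leftWeight B A) =
      (π.parts.card : ℝ) * ((π.parts.card : ℝ) - 1) := by
    simp_rw [← Finset.sum_add_distrib]
    have : ∀ A ∈ π.parts, ∑ B ∈ π.parts, ((startWeight A B + leftWeight A B) +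
        (startWeight B A + leftWeight B A)) = (π.parts.card : ℝ) - 1 := by
      intro A hA
      rw [Finset.sum_congr rfl (key A hA)]
      have h5 : ∀ B, (if A = B then (0 : ℝ) else 1) = 1 - if A = B then 1 else 0 := by
        intro B; split_ifs <;> norm_num
      simp_rw [h5, Finset.sum_sub_distrib, Finset.sum_ite_eq, if_pos hA]
      simp
    rw [Finset.sum_congr rfl this, Finset.sum_const, nsmul_eq_mul]
  linarith

theorem card_grow {C : Finset ℕ} (hC : C ∈ π.parts) :
    (insert (insert (n + 1) C) (π.parts.erase C)).card = π.parts.card := by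
  rw [Finset.card_insert_of_notMem (insert_notMem_erase π C), Finset.card_erase_add_one hC]

theorem card_grow_singleton : (insert {n + 1} π.parts).card = π.parts.card + 1 :=
  Finset.card_insert_of_notMem (insert_notMem_parts π ∅)

theorem overlappings_eq_pairSum {s : Finset ℕ} (ρ : Finpartition s) :
    (overlappings ρ : ℝ) = pairSum overlapWeight ρ.parts := by
  classical
  unfold overlappings pairSum overlapWeight
  rw [Finset.card_filter, Nat.cast_sum, Finset.sum_product]
  refine Finset.sum_congr rfl fun A hA => Finset.sum_congr rfl fun B hB => ?_
  have hAn := ρ.nonempty_of_mem_parts hA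
  have hBn := ρ.nonempty_of_mem_parts hB
  have h : Overlap A B ↔ lo A < lo B ∧ lo B < hi A ∧ hi A < hi B := by
    unfold Overlap
    rw [exists_prop_of_true hAn, exists_prop_of_true hBn,
      (A.isLeast_min' hAn).unique (isLeast_lo hAn), (B.isLeast_min' hBn).unique (isLeast_lo hBn),
      (A.isGreatest_max' hAn).unique (isGreatest_hi hAn),
      (B.isGreatest_max' hBn).unique (isGreatest_hi hBn)]
  simp only [h, Nat.cast_ite, Nat.cast_one, Nat.cast_zero]

end Grow

/-! ### Recursions for the totals over partitions with `k` blocks -/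

/-- The total of a statistic over the partitions of `[n]` with `k` blocks. -/
noncomputable def blockTotal (f : Finset (Finset ℕ) → ℝ) (n k : ℕ) : ℝ :=
  ∑ π : Finpartition (Finset.Icc 1 n), if π.parts.card = k then f π.parts else 0

theorem blockTotal_succ (f : Finset (Finset ℕ) → ℝ) (n k : ℕ) :
    blockTotal f (n + 1) k = ∑ π : Finpartition (Finset.Icc 1 n),
      ((if π.parts.card + 1 = k then f (insert {n + 1} π.parts) else 0) +
        if π.parts.card = k then
          ∑ C ∈ π.parts, f (insert (insert (n + 1) C) (π.parts.erase C)) else 0) := by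
  unfold blockTotal
  have hn : n + 1 ∉ Finset.Icc 1 n := by simp
  have ht : Finset.Icc 1 (n + 1) = insert (n + 1) (Finset.Icc 1 n) := by
    ext x; simp only [Finset.mem_Icc, Finset.mem_insert]; omega
  rw [sum_finpartition_insert hn ht (fun P => if P.card = k then f P else 0)]
  refine Finset.sum_congr rfl fun π _ => ?_
  rw [card_grow_singleton]
  congr 1
  rw [Finset.sum_congr rfl (fun C hC => by rw [card_grow π hC])]
  split_ifs <;> simp

theorem blockTotal_zero_right (f : Finset (Finset ℕ) → ℝ) (n : ℕ) :
    blockTotal f (n + 1) 0 = 0 := by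
  refine Finset.sum_eq_zero fun π _ => ?_
  rw [if_neg]
  exact (Finset.card_pos.2 (π.parts_nonempty (by simp))).ne'

theorem blockTotal_zero_left (f : Finset (Finset ℕ) → ℝ) (k : ℕ) :
    blockTotal f 0 k = if k = 0 then f ∅ else 0 := by
  have h : ∀ π : Finpartition (Finset.Icc 1 0), π.parts = ∅ := fun π => by
    rw [Finpartition.parts_eq_empty_iff]; rfl
  have : Subsingleton (Finpartition (Finset.Icc 1 0)) :=
    ⟨fun π ρ => Finpartition.ext (by rw [h, h])⟩
  unfold blockTotal
  rw [Fintype.sum_subsingleton _ ⊥, h]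
  simp [eq_comm]

theorem blockTotal_one (n k : ℕ) : blockTotal (fun _ => 1) n k = Nat.stirlingSecond n k := by
  induction n generalizing k with
  | zero => cases k <;> simp [blockTotal_zero_left]
  | succ n ih =>
    cases k with
    | zero => simp [blockTotal_zero_right]
    | succ k =>
      rw [blockTotal_succ, Nat.stirlingSecond_succ_succ]
      push_cast
      rw [← ih, ← ih, Finset.sum_add_distrib, add_comm]
      unfold blockTotal
      rw [Finset.mul_sum]
      congr 1
      refine Finset.sum_congr rfl fun π _ => ?_
      split_ifs with h
      · simp [h]
      · simp

theorem blockTotal_leftWeight_succ (n k : ℕ) :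
    blockTotal (pairSum leftWeight) (n + 1) (k + 1) =
      k * blockTotal (pairSum leftWeight) n (k + 1) + blockTotal (pairSum leftWeight) n k
        + k * Nat.stirlingSecond n k := by
  rw [blockTotal_succ, ← blockTotal_one]
  unfold blockTotal
  simp_rw [Finset.mul_sum, ← Finset.sum_add_distrib]
  refine Finset.sum_congr rfl fun π _ => ?_
  rw [leftWeight_grow_singleton, sum_leftWeight_grow]
  by_cases h1 : π.parts.card = k
  · simp [h1]
  · by_cases h2 : π.parts.card = k + 1
    · simp [h2]
    · simp [h1, h2]

theorem blockTotal_leftWeight (n k : ℕ) :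
    blockTotal (pairSum leftWeight) n (k + 1) = ((n : ℝ) - k) * Nat.stirlingSecond n k := by
  induction n generalizing k with
  | zero => cases k <;> simp [blockTotal_zero_left]
  | succ n ih =>
    rw [blockTotal_leftWeight_succ, ih]
    cases k with
    | zero =>
      cases n <;> simp [blockTotal_zero_right, blockTotal_zero_left, pairSum]
    | succ k =>
      rw [ih, Nat.stirlingSecond_succ_succ]
      push_cast
      ring

/-- The start statistic is eliminated through `startWeight_add_leftWeight`, leaving only the left
statistic, whose total is known. -/
theorem blockTotal_overlapWeight_succ (n k : ℕ) :
    blockTotal (pairSum overlapWeight) (n + 1) (k + 1) =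
      ((k : ℝ) - 1) * blockTotal (pairSum overlapWeight) n (k + 1)
        + blockTotal (pairSum overlapWeight) n k
        + ((k : ℝ) + 1) * k / 2 * Nat.stirlingSecond n (k + 1)
        - blockTotal (pairSum leftWeight) n (k + 1) := by
  rw [blockTotal_succ, ← blockTotal_one]
  unfold blockTotal
  simp_rw [Finset.mul_sum, ← Finset.sum_add_distrib, ← Finset.sum_sub_distrib]
  refine Finset.sum_congr rfl fun π _ => ?_
  have h := startWeight_add_leftWeight π
  rw [overlapWeight_grow_singleton, sum_overlapWeight_grow]
  by_cases h1 : π.parts.card = k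
  · simp [h1]
  · by_cases h2 : π.parts.card = k + 1
    · rw [h2] at h
      simp only [h2, if_true, if_neg (show k + 1 + 1 ≠ k + 1 by omega),
        if_neg (show k + 1 ≠ k by omega)]
      push_cast at h ⊢
      linarith
    · simp [h1, h2]

theorem blockTotal_overlapWeight (n k : ℕ) :
    blockTotal (pairSum overlapWeight) n (k + 1) =
      1 / 2 * (((k : ℝ) + 1) * k / 2) * Nat.stirlingSecond n (k + 1)
        + n * k / 2 * Nat.stirlingSecond (n - 1) k
        - 3 / 2 * ((n : ℝ) - k) * Nat.stirlingSecond n k := by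
  induction n generalizing k with
  | zero => cases k <;> simp [blockTotal_zero_left]
  | succ n ih =>
    rw [blockTotal_overlapWeight_succ, ih, blockTotal_leftWeight]
    cases k with
    | zero => cases n <;> simp [blockTotal_zero_right, blockTotal_zero_left, pairSum]
    | succ k =>
      rw [ih]
      -- The truncated `n - 1` in the Stirling index needs `n = 0` apart; otherwise everything
      -- reduces by the Stirling recursion.
      cases n with
      | zero =>
        cases k <;> simp [Nat.stirlingSecond_succ_succ]
      | succ n =>
        simp only [Nat.add_sub_cancel]
        rw [Nat.stirlingSecond_succ_succ (n + 1) (k + 1), Nat.stirlingSecond_succ_succ (n + 1) k,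
          Nat.stirlingSecond_succ_succ n k]
        push_cast
        ring

/-! ### Means as quotients of totals -/

theorem meanOverlappingsBlocks_eq (n k : ℕ) :
    meanOverlappingsBlocks n k =
      blockTotal (pairSum overlapWeight) n k / Nat.stirlingSecond n k := by
  unfold meanOverlappingsBlocks
  congr 1
  · unfold blockPartitions setPartitions blockTotal
    rw [Finset.sum_filter]
    simp_rw [overlappings_eq_pairSum]
  · rw [← blockTotal_one, Finset.card_eq_sum_ones, Nat.cast_sum]
    unfold blockPartitions setPartitions blockTotal
    rw [Finset.sum_filter]
    simp

theorem stirlingSecond_pos : ∀ {n k : ℕ}, k ≤ n → 0 < Nat.stirlingSecond (n + 1) (k + 1)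
  | 0, 0, _ => by simp [Nat.stirlingSecond_succ_succ]
  | n + 1, k, hk => by
    rw [Nat.stirlingSecond_succ_succ]
    rcases Nat.lt_or_ge n k with h | h
    · obtain rfl : k = n + 1 := by omega
      have := stirlingSecond_pos (le_refl n)
      omega
    · have := stirlingSecond_pos h
      positivity

theorem meanOverlappingsBlocks_formula (n k : ℕ) (hk : 1 ≤ k) (hkn : k ≤ n) :
    meanOverlappingsBlocks n k =
        1 / 2 * (Nat.choose k 2 : ℝ)
          + (n : ℝ) * ((k : ℝ) - 1) / 2 *
              ((Nat.stirlingSecond (n - 1) (k - 1) : ℝ) / (Nat.stirlingSecond n k : ℝ))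
          - 3 / 2 * ((n : ℝ) + 1 - (k : ℝ)) *
              ((Nat.stirlingSecond n (k - 1) : ℝ) / (Nat.stirlingSecond n k : ℝ)) := by
  obtain ⟨k, rfl⟩ := Nat.exists_eq_add_of_le' hk
  obtain ⟨n, rfl⟩ := Nat.exists_eq_add_of_le' (hk.trans hkn)
  have hpos : (0 : ℝ) < Nat.stirlingSecond (n + 1) (k + 1) := by
    exact_mod_cast stirlingSecond_pos (by omega : k ≤ n)
  rw [meanOverlappingsBlocks_eq, blockTotal_overlapWeight, Nat.cast_choose_two]
  simp only [Nat.add_sub_cancel]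
  push_cast
  field_simp
  ring

theorem meanOverlappings_eq (n : ℕ) :
    meanOverlappings n = (∑ k ∈ Finset.range (n + 1), blockTotal (pairSum overlapWeight) n k) /
      ∑ k ∈ Finset.range (n + 1), (Nat.stirlingSecond n k : ℝ) := by
  have hsum : ∀ f : Finset (Finset ℕ) → ℝ, ∑ k ∈ Finset.range (n + 1), blockTotal f n k =
      ∑ π : Finpartition (Finset.Icc 1 n), f π.parts := by
    intro f
    unfold blockTotal
    rw [Finset.sum_comm]
    refine Finset.sum_congr rfl fun π _ => ?_
    rw [Finset.sum_ite_eq, if_pos]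
    have := π.card_parts_le_card
    simp only [Nat.card_Icc, Finset.mem_range] at this ⊢
    omega
  unfold meanOverlappings setPartitions
  simp_rw [← blockTotal_one, hsum, overlappings_eq_pairSum]
  simp

/-! ### Dobinski's formula -/

/-- The Dobinski weights `m ^ n / m!`. -/
noncomputable def dobinskiTerm (n m : ℕ) : ℝ := (m : ℝ) ^ n / m.factorial

theorem dobinskiTerm_succ_succ (n m : ℕ) :
    dobinskiTerm (n + 1) (m + 1) = ((m : ℝ) + 1) ^ n / m.factorial := by
  unfold dobinskiTerm
  rw [Nat.factorial_succ]
  push_cast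
  have : (m.factorial : ℝ) ≠ 0 := by positivity
  field_simp
  ring

/-- Cancelling `m+1` against the factorial leaves `(m+1)^n / m!`; the binomial expansion then gives
the Bell recursion. -/
theorem hasSum_dobinskiTerm_shift {n : ℕ} {b : ℕ → ℝ}
    (h : ∀ k ≤ n, HasSum (dobinskiTerm k) (b k)) :
    HasSum (dobinskiTerm (n + 1)) (∑ k ∈ Finset.range (n + 1), (n.choose k : ℝ) * b k) := by
  rw [← hasSum_nat_add_iff' 1]
  have h2 : ∀ m : ℕ, dobinskiTerm (n + 1) (m + 1) =
      ∑ k ∈ Finset.range (n + 1), (n.choose k : ℝ) * dobinskiTerm k m := by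
    intro m
    rw [dobinskiTerm_succ_succ, add_pow, Finset.sum_div]
    refine Finset.sum_congr rfl fun k _ => ?_
    unfold dobinskiTerm
    simp only [one_pow, mul_one]
    ring
  simp_rw [h2]
  have h0 : ∑ i ∈ Finset.range 1, dobinskiTerm (n + 1) i = 0 := by simp [dobinskiTerm]
  rw [h0, sub_zero]
  exact hasSum_sum fun k hk => (h k (by simpa [Nat.lt_succ_iff] using hk)).mul_left _

theorem hasSum_inv_factorial : HasSum (fun m : ℕ => ((m.factorial : ℝ))⁻¹) (Real.exp 1) := by
  have h := NormedSpace.expSeries_div_hasSum_exp (𝔸 := ℝ) 1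
  rw [← Real.exp_eq_exp_ℝ] at h
  simpa using h

theorem hasSum_dobinskiTerm (n : ℕ) :
    HasSum (dobinskiTerm n) (Real.exp 1 * Nat.bell n) := by
  induction n using Nat.strong_induction_on with
  | _ n ih =>
    cases n with
    | zero =>
      convert hasSum_inv_factorial using 1
      · ext m; simp [dobinskiTerm]
      · simp
    | succ n =>
      have h := hasSum_dobinskiTerm_shift (n := n) (b := fun k => Real.exp 1 * Nat.bell k)
        (fun k hk => ih k (Nat.lt_succ_of_le hk))
      convert h using 1
      rw [Nat.bell_succ, ← Nat.range_succ_eq_Iic, ← Finset.sum_range_reflect, Nat.cast_sum,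
        Finset.mul_sum]
      refine Finset.sum_congr rfl fun k hk => ?_
      have hk' : k ≤ n := by simpa [Nat.lt_succ_iff] using hk
      have h1 : n + 1 - 1 - k = n - k := by omega
      rw [h1, Nat.choose_symm hk', Nat.sub_sub_self hk']
      push_cast
      ring

theorem bell_pos (n : ℕ) : (0 : ℝ) < Nat.bell n := by
  have h := hasSum_dobinskiTerm n
  have h1 : dobinskiTerm n 1 ≤ Real.exp 1 * Nat.bell n :=
    le_hasSum h 1 fun m _ => by unfold dobinskiTerm; positivity
  have h2 : dobinskiTerm n 1 = 1 := by simp [dobinskiTerm]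
  have h3 := Real.exp_pos 1
  by_contra hneg
  have : (Nat.bell n : ℝ) = 0 := le_antisymm (not_lt.1 hneg) (Nat.cast_nonneg _)
  rw [this, h2] at h1
  norm_num at h1

/-! ### Stirling moments as Bell numbers -/

/-- The Stirling recursion moved onto the test function. Falling factorials as `g` give the
expansion of powers, polynomials in `k` give the moments. -/
theorem sum_stirlingSecond_succ (g : ℕ → ℝ) (n : ℕ) :
    ∑ k ∈ Finset.range (n + 2), (Nat.stirlingSecond (n + 1) k : ℝ) * g k =
      ∑ k ∈ Finset.range (n + 1), (Nat.stirlingSecond n k : ℝ) * (k * g k + g (k + 1)) := by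
  have h1 : ∑ k ∈ Finset.range (n + 1), (k : ℝ) * Nat.stirlingSecond n k * g k =
      ∑ k ∈ Finset.range (n + 1),
        ((k : ℝ) + 1) * Nat.stirlingSecond n (k + 1) * g (k + 1) := by
    have h := Finset.sum_range_succ' (fun k : ℕ => (k : ℝ) * Nat.stirlingSecond n k * g k) (n + 1)
    rw [Finset.sum_range_succ, Nat.stirlingSecond_eq_zero_of_lt (Nat.lt_succ_self n)] at h
    simpa using h
  have h2 : ∑ k ∈ Finset.range (n + 1), (Nat.stirlingSecond n k : ℝ) * (k * g k + g (k + 1)) =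
      ∑ k ∈ Finset.range (n + 1), (k : ℝ) * Nat.stirlingSecond n k * g k +
        ∑ k ∈ Finset.range (n + 1), (Nat.stirlingSecond n k : ℝ) * g (k + 1) := by
    rw [← Finset.sum_add_distrib]
    exact Finset.sum_congr rfl fun k _ => by ring
  rw [h2, h1, ← Finset.sum_add_distrib, Finset.sum_range_succ']
  simp only [Nat.stirlingSecond_succ_zero, Nat.cast_zero, zero_mul, add_zero]
  refine Finset.sum_congr rfl fun k _ => ?_
  rw [Nat.stirlingSecond_succ_succ]
  push_cast
  ring

theorem pow_eq_sum_stirlingSecond (n m : ℕ) :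
    (m : ℝ) ^ n =
      ∑ k ∈ Finset.range (n + 1), (Nat.stirlingSecond n k : ℝ) * m.descFactorial k := by
  induction n with
  | zero => simp
  | succ n ih =>
    rw [sum_stirlingSecond_succ (fun k => (m.descFactorial k : ℝ)), pow_succ, ih, Finset.sum_mul]
    refine Finset.sum_congr rfl fun k _ => ?_
    rw [mul_assoc]
    congr 1
    rw [Nat.descFactorial_succ]
    rcases le_or_gt k m with h | h
    · push_cast [h]
      ring
    · simp [Nat.descFactorial_of_lt h]

theorem hasSum_descFactorial_div (k : ℕ) :
    HasSum (fun m : ℕ => (m.descFactorial k : ℝ) / m.factorial) (Real.exp 1) := by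
  rw [← hasSum_nat_add_iff' k, Finset.sum_eq_zero, sub_zero]
  · have hcongr : ∀ m : ℕ, ((m + k).descFactorial k : ℝ) / ((m + k).factorial : ℝ) =
        ((m.factorial : ℝ))⁻¹ := ?_
    · simp_rw [hcongr]
      exact hasSum_inv_factorial
    intro m
    have h := Nat.factorial_mul_descFactorial (Nat.le_add_left k m)
    rw [Nat.add_sub_cancel] at h
    rw [← h]
    push_cast
    have h1 : (m.factorial : ℝ) ≠ 0 := by positivity
    have h2 : ((m + k).descFactorial k : ℝ) ≠ 0 := by
      rw [Nat.cast_ne_zero, Ne, Nat.descFactorial_eq_zero_iff_lt]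
      omega
    field_simp
  · intro m hm
    simp [Nat.descFactorial_of_lt (Finset.mem_range.1 hm)]

/-- The Dobinski series is summed a second way: powers expand in falling factorials, each of which
contributes `e`. -/
theorem sum_stirlingSecond (n : ℕ) :
    ∑ k ∈ Finset.range (n + 1), (Nat.stirlingSecond n k : ℝ) = Nat.bell n := by
  have h : HasSum (dobinskiTerm n)
      (∑ k ∈ Finset.range (n + 1), (Nat.stirlingSecond n k : ℝ) * Real.exp 1) := by
    have hterm : dobinskiTerm n = fun m => ∑ k ∈ Finset.range (n + 1),
        (Nat.stirlingSecond n k : ℝ) * ((m.descFactorial k : ℝ) / m.factorial) := ?_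
    · rw [hterm]
      exact hasSum_sum fun k _ =>
        (hasSum_descFactorial_div k).mul_left (Nat.stirlingSecond n k : ℝ)
    funext m
    unfold dobinskiTerm
    rw [pow_eq_sum_stirlingSecond, Finset.sum_div]
    exact Finset.sum_congr rfl fun k _ => by ring
  have h2 := h.unique (hasSum_dobinskiTerm n)
  rw [← Finset.sum_mul, mul_comm] at h2
  exact mul_left_cancel₀ (Real.exp_pos 1).ne' h2

theorem sum_stirlingSecond_mul_succ (n : ℕ) :
    ∑ k ∈ Finset.range (n + 1), (Nat.stirlingSecond n k : ℝ) * (k + 1) = Nat.bell (n + 1) := by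
  rw [← sum_stirlingSecond]
  have h := sum_stirlingSecond_succ (fun _ => 1) n
  simp only [mul_one] at h
  exact h.symm

theorem sum_stirlingSecond_mul_quadratic (n : ℕ) :
    ∑ k ∈ Finset.range (n + 1), (Nat.stirlingSecond n k : ℝ) * ((k : ℝ) * (k + 1) + (k + 2)) =
      Nat.bell (n + 2) := by
  rw [← sum_stirlingSecond_mul_succ, sum_stirlingSecond_succ (fun k => (k : ℝ) + 1)]
  refine Finset.sum_congr rfl fun k _ => ?_
  push_cast
  ring

theorem sum_stirlingSecond_mul_id (n : ℕ) :
    ∑ k ∈ Finset.range (n + 1), (Nat.stirlingSecond n k : ℝ) * k =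
      Nat.bell (n + 1) - Nat.bell n := by
  rw [← sum_stirlingSecond_mul_succ, ← sum_stirlingSecond, ← Finset.sum_sub_distrib]
  exact Finset.sum_congr rfl fun k _ => by ring

theorem sum_stirlingSecond_mul_choose_two (n : ℕ) :
    ∑ k ∈ Finset.range (n + 1), (Nat.stirlingSecond n k : ℝ) * ((k : ℝ) * (k - 1)) =
      Nat.bell (n + 2) - 3 * Nat.bell (n + 1) + Nat.bell n := by
  rw [← sum_stirlingSecond_mul_quadratic, ← sum_stirlingSecond_mul_succ, ← sum_stirlingSecond,
    Finset.mul_sum, ← Finset.sum_sub_distrib, ← Finset.sum_add_distrib]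
  exact Finset.sum_congr rfl fun k _ => by ring

theorem sum_blockTotal_overlapWeight (n : ℕ) :
    ∑ k ∈ Finset.range (n + 2), blockTotal (pairSum overlapWeight) (n + 1) k =
      1 / 4 * Nat.bell (n + 3) + 3 / 4 * Nat.bell (n + 2)
        - ((n + 1 : ℝ) + 5 / 4) * Nat.bell (n + 1) - (n + 1 : ℝ) / 2 * Nat.bell n := by
  rw [Finset.sum_range_succ', blockTotal_zero_right, add_zero]
  simp_rw [blockTotal_overlapWeight, Nat.add_sub_cancel]
  have h1 := sum_stirlingSecond_mul_choose_two (n + 1)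
  rw [Finset.sum_range_succ'] at h1
  have h2 := sum_stirlingSecond_mul_id n
  have h3 := sum_stirlingSecond_mul_id (n + 1)
  have h4 := sum_stirlingSecond (n + 1)
  rw [Finset.sum_range_succ] at h3 h4
  have h5 : ∀ k : ℕ, 1 / 2 * (((k : ℝ) + 1) * k / 2) * (Nat.stirlingSecond (n + 1) (k + 1) : ℝ)
        + ((n + 1 : ℕ) : ℝ) * k / 2 * Nat.stirlingSecond n k
        - 3 / 2 * (((n + 1 : ℕ) : ℝ) - k) * Nat.stirlingSecond (n + 1) k =
      1 / 4 * ((Nat.stirlingSecond (n + 1) (k + 1) : ℝ) *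
          (((k + 1 : ℕ) : ℝ) * (((k + 1 : ℕ) : ℝ) - 1)))
        + ((n : ℝ) + 1) / 2 * ((Nat.stirlingSecond n k : ℝ) * k)
        - 3 / 2 * ((n : ℝ) + 1) * Nat.stirlingSecond (n + 1) k
        + 3 / 2 * ((Nat.stirlingSecond (n + 1) k : ℝ) * k) := by
    intro k
    push_cast
    ring
  simp_rw [h5, Finset.sum_add_distrib, Finset.sum_sub_distrib, Finset.sum_add_distrib,
    ← Finset.mul_sum]
  rw [h2]
  push_cast at h1 h3 h4 ⊢
  rw [zero_mul, mul_zero, add_zero] at h1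
  rw [h1, eq_sub_of_add_eq h3, eq_sub_of_add_eq h4]
  ring

theorem meanOverlappings_formula (n : ℕ) (hn : 1 ≤ n) :
    meanOverlappings n =
        1 / 4 * ((Nat.bell (n + 2) : ℝ) / (Nat.bell n : ℝ))
          + 3 / 4 * ((Nat.bell (n + 1) : ℝ) / (Nat.bell n : ℝ))
          - ((n : ℝ) + 5 / 4)
          - (n : ℝ) / 2 * ((Nat.bell (n - 1) : ℝ) / (Nat.bell n : ℝ)) := by
  obtain ⟨n, rfl⟩ := Nat.exists_eq_add_of_le' hn
  have hb := bell_pos (n + 1)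
  rw [meanOverlappings_eq, sum_blockTotal_overlapWeight, sum_stirlingSecond, Nat.add_sub_cancel]
  push_cast
  field_simp

/-! ### Asymptotics for a fixed number of blocks -/

theorem stirlingSecond_le_pow (n k : ℕ) : (Nat.stirlingSecond n k : ℝ) ≤ (k : ℝ) ^ n := by
  rcases le_or_gt k n with h | h
  · rw [pow_eq_sum_stirlingSecond]
    have h1 := Finset.single_le_sum (s := Finset.range (n + 1))
      (f := fun j => (Nat.stirlingSecond n j : ℝ) * k.descFactorial j)
      (fun _ _ => by positivity) (Finset.mem_range.2 (Nat.lt_succ_of_le h))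
    refine le_trans ?_ h1
    have h2 : (1 : ℝ) ≤ k.descFactorial k := by
      rw [Nat.descFactorial_self]
      exact_mod_cast Nat.factorial_pos k
    exact le_mul_of_one_le_right (Nat.cast_nonneg _) h2
  · rw [Nat.stirlingSecond_eq_zero_of_lt h, Nat.cast_zero]
    positivity

theorem pow_le_stirlingSecond (m k : ℕ) :
    (k + 1) ^ m ≤ Nat.stirlingSecond (k + 1 + m) (k + 1) := by
  induction m with
  | zero => simp [Nat.stirlingSecond_self]
  | succ m ih =>
    rw [← add_assoc, Nat.stirlingSecond_succ_succ, pow_succ, mul_comm]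
    exact (Nat.mul_le_mul_left _ ih).trans (Nat.le_add_right _ _)

theorem stirlingSecond_ratio_le {n k : ℕ} (h : k + 1 ≤ n) :
    (k : ℝ) ^ n / Nat.stirlingSecond n (k + 1) ≤
      ((k : ℝ) + 1) ^ (k + 1) * ((k : ℝ) / (k + 1)) ^ n := by
  obtain ⟨m, rfl⟩ := Nat.exists_eq_add_of_le h
  have h1 : ((k : ℝ) + 1) ^ m ≤ Nat.stirlingSecond (k + 1 + m) (k + 1) := by
    exact_mod_cast pow_le_stirlingSecond m k
  have h2 : (0 : ℝ) < ((k : ℝ) + 1) ^ m := by positivity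
  refine (div_le_div_of_nonneg_left (by positivity) h2 h1).trans (le_of_eq ?_)
  rw [div_pow, pow_add ((k : ℝ) + 1) (k + 1) m]
  field_simp

theorem tendsto_meanOverlappingsBlocks (k : ℕ) (hk : 1 ≤ k) :
    Tendsto (fun n : ℕ => meanOverlappingsBlocks n k - 1 / 2 * (Nat.choose k 2 : ℝ))
      atTop (𝓝 0) := by
  obtain ⟨k, rfl⟩ := Nat.exists_eq_add_of_le' hk
  -- The constant 2 is `1/2 + 3/2`, from the coefficients of the two correction terms.
  have hr : Tendsto (fun n : ℕ => 2 * ((k : ℝ) + 1) ^ (k + 1) *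
      ((n : ℝ) * ((k : ℝ) / (k + 1)) ^ n)) atTop (𝓝 0) := by
    have := (tendsto_self_mul_const_pow_of_lt_one (r := (k : ℝ) / (k + 1)) (by positivity)
      (by rw [div_lt_one (by positivity)]; linarith)).const_mul (2 * ((k : ℝ) + 1) ^ (k + 1))
    simpa using this
  refine squeeze_zero_norm' ?_ hr
  filter_upwards [eventually_ge_atTop (k + 1)] with n hn
  rw [meanOverlappingsBlocks_formula n (k + 1) hk hn]
  obtain ⟨m, rfl⟩ := Nat.exists_eq_add_of_le' (hk.trans hn)
  have hS : (0 : ℝ) < Nat.stirlingSecond (m + 1) (k + 1) := by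
    exact_mod_cast stirlingSecond_pos (by omega : k ≤ m)
  have h1 := stirlingSecond_le_pow m k
  have h2 := stirlingSecond_le_pow (m + 1) k
  have h3 := stirlingSecond_ratio_le hn
  have hkm : (k : ℝ) ≤ m := by exact_mod_cast (by omega : k ≤ m)
  have hk0 : (0 : ℝ) ≤ k := Nat.cast_nonneg k
  -- The factor `k` raises `k^m` to `k^(m+1)`, so one bound serves both corrections.
  have e1 : (k : ℝ) * (Nat.stirlingSecond m k / Nat.stirlingSecond (m + 1) (k + 1)) ≤
      ((k : ℝ) + 1) ^ (k + 1) * ((k : ℝ) / (k + 1)) ^ (m + 1) := by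
    refine le_trans ?_ h3
    rw [← mul_div_assoc]
    gcongr
    rw [pow_succ, mul_comm]
    gcongr
  have e2 : (Nat.stirlingSecond (m + 1) k : ℝ) / Nat.stirlingSecond (m + 1) (k + 1) ≤
      ((k : ℝ) + 1) ^ (k + 1) * ((k : ℝ) / (k + 1)) ^ (m + 1) :=
    (div_le_div_of_nonneg_right h2 hS.le).trans h3
  set R := ((k : ℝ) + 1) ^ (k + 1) * ((k : ℝ) / (k + 1)) ^ (m + 1)
  have f1 : (0 : ℝ) ≤ (k : ℝ) * (Nat.stirlingSecond m k / Nat.stirlingSecond (m + 1) (k + 1)) := by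
    positivity
  have f2 : (0 : ℝ) ≤ (Nat.stirlingSecond (m + 1) k : ℝ) / Nat.stirlingSecond (m + 1) (k + 1) := by
    positivity
  simp only [Nat.add_sub_cancel]
  push_cast
  set x := (k : ℝ) * ((Nat.stirlingSecond m k : ℝ) / Nat.stirlingSecond (m + 1) (k + 1)) with hx
  set y := (Nat.stirlingSecond (m + 1) k : ℝ) / Nat.stirlingSecond (m + 1) (k + 1)
  have hx' : ((m : ℝ) + 1) * ((k : ℝ) + 1 - 1) / 2 *
      ((Nat.stirlingSecond m k : ℝ) / Nat.stirlingSecond (m + 1) (k + 1)) =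
      ((m : ℝ) + 1) / 2 * x := by rw [hx]; ring
  have hgoal : 2 * ((k : ℝ) + 1) ^ (k + 1) *
      (((m : ℝ) + 1) * ((k : ℝ) / (k + 1)) ^ (m + 1)) = 2 * (((m : ℝ) + 1) * R) := by ring
  rw [hx', hgoal, Real.norm_eq_abs, abs_le]
  have g1 : ((m : ℝ) + 1) * x ≤ ((m : ℝ) + 1) * R := by gcongr
  have g2 : ((m : ℝ) + 1 + 1 - (k + 1)) * y ≤ ((m : ℝ) + 1) * R := by
    apply mul_le_mul _ e2 f2 (by positivity)
    linarith
  have g3 : 0 ≤ ((m : ℝ) + 1) * x := by positivity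
  have g4 : 0 ≤ ((m : ℝ) + 1 + 1 - (k + 1)) * y := mul_nonneg (by linarith) f2
  constructor <;> linarith

/-! ### Ratios of consecutive Bell numbers -/

theorem pow_tangent_le {p q : ℝ} (hp : 0 < p) (hq : 0 ≤ q) (n : ℕ) :
    p ^ (n + 1) + (n + 1) * p ^ n * (q - p) ≤ q ^ (n + 1) := by
  have h := one_add_mul_le_pow (a := q / p - 1) (by
    have : 0 ≤ q / p := by positivity
    linarith) (n + 1)
  have h1 : (1 + (q / p - 1)) ^ (n + 1) = q ^ (n + 1) / p ^ (n + 1) := by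
    rw [add_sub_cancel, div_pow]
  rw [h1, le_div_iff₀ (by positivity)] at h
  refine le_trans (le_of_eq ?_) h
  push_cast
  field_simp
  ring

theorem hasSum_dobinskiTerm_succ (n : ℕ) :
    HasSum (fun m => dobinskiTerm (n + 1) (m + 1)) (Real.exp 1 * Nat.bell (n + 1)) := by
  have h := (hasSum_nat_add_iff' 1).2 (hasSum_dobinskiTerm (n + 1))
  simpa [dobinskiTerm] using h

/-- The ratio of consecutive Bell numbers. -/
noncomputable def bellRatio (n : ℕ) : ℝ := (Nat.bell (n + 1) : ℝ) / Nat.bell n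

theorem bellRatio_pos (n : ℕ) : 0 < bellRatio n := div_pos (bell_pos _) (bell_pos _)

theorem bell_succ_eq_bellRatio_mul (n : ℕ) :
    (Nat.bell (n + 1) : ℝ) = bellRatio n * Nat.bell n := by
  rw [bellRatio, div_mul_cancel₀ _ (bell_pos n).ne']

/-- The Dobinski sum of `m^n (m-a)^2 / m!` is nonnegative; at `a = B_{n+2}/B_{n+1}` it equals `e a
(a B_n - B_{n+1})`. -/
theorem bell_logConvex (n : ℕ) :
    (Nat.bell (n + 1) : ℝ) ≤ bellRatio (n + 1) * Nat.bell n := by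
  set a := bellRatio (n + 1) with ha
  have ha0 : 0 < a := bellRatio_pos _
  have h := ((hasSum_dobinskiTerm (n + 2)).sub ((hasSum_dobinskiTerm (n + 1)).mul_left (2 * a))).add
    ((hasSum_dobinskiTerm n).mul_left (a ^ 2))
  have h0 := h.nonneg fun m => by
    have : dobinskiTerm (n + 2) m - 2 * a * dobinskiTerm (n + 1) m + a ^ 2 * dobinskiTerm n m =
        (m : ℝ) ^ n * (m - a) ^ 2 / m.factorial := by
      unfold dobinskiTerm
      ring
    rw [this]
    positivity
  have h1 := bell_succ_eq_bellRatio_mul (n + 1)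
  rw [← ha] at h1
  have h2 : 0 ≤ Real.exp 1 * a * (a * Nat.bell n - Nat.bell (n + 1)) := by
    rw [h1] at h0
    linarith
  have h3 := nonneg_of_mul_nonneg_right h2 (mul_pos (Real.exp_pos 1) ha0)
  linarith

/-- Jensen for `(1+x)^N`, `N = n+2`, at `x = 1/m` with weights `m^N/m!`. The mean of `x` is
`B_{N-1}/B_N ≥ 1/a` by log-convexity, and the mean of `(1+x)^N` is `a`. The tangent at `1/a` has
slope `β`. -/
theorem one_add_inv_pow_le_bellRatio (n : ℕ) :
    (1 + (bellRatio (n + 2))⁻¹) ^ (n + 2) ≤ bellRatio (n + 2) := by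
  set a := bellRatio (n + 2) with ha
  have ha0 : 0 < a := bellRatio_pos _
  set p := 1 + a⁻¹ with hp
  have hp0 : 0 < p := by positivity
  set β : ℝ := (n + 2) * p ^ (n + 1) with hβ
  have hβ0 : 0 ≤ β := by positivity
  have h1 := ((hasSum_dobinskiTerm (n + 2)).mul_left (p ^ (n + 2) - β * a⁻¹)).add
    ((hasSum_dobinskiTerm (n + 1)).mul_left β)
  have h2 := hasSum_dobinskiTerm_succ (n + 2)
  have h3 := hasSum_le (fun m => ?_) h1 h2
  · have h4 := bell_logConvex (n + 1)
    have h5 := bell_succ_eq_bellRatio_mul (n + 2)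
    rw [← ha] at h4 h5
    have hb := bell_pos (n + 2)
    have h6 : (Nat.bell (n + 2) : ℝ) * a⁻¹ ≤ Nat.bell (n + 1) := by
      rw [← div_eq_mul_inv, div_le_iff₀ ha0]
      linarith
    have h7 : Real.exp 1 * (Nat.bell (n + 2) * p ^ (n + 2)) ≤
        Real.exp 1 * (Nat.bell (n + 2) * a) := by
      have h8 := mul_le_mul_of_nonneg_left h6 (mul_nonneg (Real.exp_pos 1).le hβ0)
      rw [h5] at h3
      linarith
    exact le_of_mul_le_mul_left (le_of_mul_le_mul_left h7 (Real.exp_pos 1)) hb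
  · rw [dobinskiTerm_succ_succ]
    rcases Nat.eq_zero_or_pos m with rfl | hm
    -- At `m = 0` the weights vanish, so `1/m` is not needed.
    · simp [dobinskiTerm]
    · have hm0 : (0 : ℝ) < m := by exact_mod_cast hm
      have h4 := pow_tangent_le hp0 (q := 1 + (m : ℝ)⁻¹) (by positivity) (n + 1)
      have h5 : (p ^ (n + 2) - β * a⁻¹) * dobinskiTerm (n + 2) m + β * dobinskiTerm (n + 1) m =
          (p ^ (n + 1 + 1) + (((n + 1 : ℕ) : ℝ) + 1) * p ^ (n + 1) * (1 + (m : ℝ)⁻¹ - p)) *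
            ((m : ℝ) ^ (n + 2) / m.factorial) := by
        rw [hβ, hp]
        unfold dobinskiTerm
        push_cast
        field_simp
        ring
      have h6 : ((m : ℝ) + 1) ^ (n + 2) / m.factorial =
          (1 + (m : ℝ)⁻¹) ^ (n + 1 + 1) * ((m : ℝ) ^ (n + 2) / m.factorial) := by
        rw [← mul_div_assoc, ← mul_pow]
        congr 2
        field_simp
      rw [h5, h6]
      gcongr

theorem one_lt_bellRatio (n : ℕ) : 1 < bellRatio (n + 2) := by
  refine lt_of_lt_of_le ?_ (one_add_inv_pow_le_bellRatio n)
  have := bellRatio_pos (n + 2)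
  exact one_lt_pow₀ (lt_add_of_pos_right _ (by positivity)) (by omega)

/-- Jensen for `(1-x)^N`, `N = n+2`, at `x = 1/(m+1)` with weights `(m+1)^N/m!`: the mean of `x` is
exactly `1/a`, and so is the mean of `(1-x)^N`. -/
theorem bellRatio_mul_one_sub_inv_pow_le (n : ℕ) :
    bellRatio (n + 2) * (1 - (bellRatio (n + 2))⁻¹) ^ (n + 2) ≤ 1 := by
  set a := bellRatio (n + 2) with ha
  have ha1 : 1 < a := one_lt_bellRatio n
  have ha0 : 0 < a := by linarith
  set p := 1 - a⁻¹ with hp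
  have hp0 : 0 < p := by
    have := inv_lt_one_of_one_lt₀ ha1
    linarith
  set β : ℝ := (n + 2) * p ^ (n + 1) with hβ
  have h1 := ((hasSum_dobinskiTerm_succ (n + 2)).mul_left (p ^ (n + 2) + β * a⁻¹)).sub
    ((hasSum_dobinskiTerm_succ (n + 1)).mul_left β)
  have h2 := hasSum_dobinskiTerm (n + 2)
  have h3 := hasSum_le (fun m => ?_) h1 h2
  · have h5 := bell_succ_eq_bellRatio_mul (n + 2)
    rw [← ha] at h5
    have hb := bell_pos (n + 2)
    have h7 : Real.exp 1 * (Nat.bell (n + 2) * (a * p ^ (n + 2))) ≤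
        Real.exp 1 * (Nat.bell (n + 2) * 1) := by
      rw [h5] at h3
      have h8 : β * a⁻¹ * (Real.exp 1 * (a * Nat.bell (n + 2))) =
          β * (Real.exp 1 * Nat.bell (n + 2)) := by field_simp
      linarith
    exact le_of_mul_le_mul_left (le_of_mul_le_mul_left h7 (Real.exp_pos 1)) hb
  · rw [dobinskiTerm_succ_succ, dobinskiTerm_succ_succ]
    have hm1 : (0 : ℝ) < (m : ℝ) + 1 := by positivity
    have hq : (0 : ℝ) ≤ 1 - ((m : ℝ) + 1)⁻¹ := by
      have : ((m : ℝ) + 1)⁻¹ ≤ 1 :=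
        inv_le_one_of_one_le₀ (by linarith [(Nat.cast_nonneg m : (0 : ℝ) ≤ m)])
      linarith
    have h4 := pow_tangent_le hp0 hq (n + 1)
    have h5 : (p ^ (n + 2) + β * a⁻¹) * (((m : ℝ) + 1) ^ (n + 2) / m.factorial) -
        β * (((m : ℝ) + 1) ^ (n + 1) / m.factorial) =
        (p ^ (n + 1 + 1) + (((n + 1 : ℕ) : ℝ) + 1) * p ^ (n + 1) *
          (1 - ((m : ℝ) + 1)⁻¹ - p)) * (((m : ℝ) + 1) ^ (n + 2) / m.factorial) := by
      rw [hβ, hp]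
      push_cast
      field_simp
      ring
    have h6 : dobinskiTerm (n + 2) m =
        (1 - ((m : ℝ) + 1)⁻¹) ^ (n + 1 + 1) * (((m : ℝ) + 1) ^ (n + 2) / m.factorial) := by
      unfold dobinskiTerm
      rw [← mul_div_assoc, ← mul_pow]
      congr 2
      field_simp
      ring
    rw [h5, h6]
    gcongr

theorem abs_sub_bellRatio_mul_log_le (n : ℕ) :
    |((n + 2 : ℕ) : ℝ) - bellRatio (n + 2) * Real.log (bellRatio (n + 2))| ≤
      Real.log (bellRatio (n + 2)) := by
  have h1 := one_add_inv_pow_le_bellRatio n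
  have h2 := bellRatio_mul_one_sub_inv_pow_le n
  have ha1 := one_lt_bellRatio n
  set a := bellRatio (n + 2)
  have ha0 : 0 < a := by linarith
  have ha2 : 0 < a - 1 := by linarith
  set N : ℝ := ((n + 2 : ℕ) : ℝ) with hN
  have hN0 : 0 ≤ N := Nat.cast_nonneg _
  have h3 : N * Real.log (1 + a⁻¹) ≤ Real.log a := by
    rw [hN, ← Real.log_pow]
    exact Real.log_le_log (by positivity) h1
  have h4 : 1 / (a + 1) ≤ Real.log (1 + a⁻¹) := by
    refine le_trans (le_of_eq ?_) (Real.one_sub_inv_le_log_of_pos (by positivity))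
    field_simp
    ring
  have h5 : N ≤ Real.log a * (a + 1) := by
    have := (mul_le_mul_of_nonneg_left h4 hN0).trans h3
    rw [mul_one_div, div_le_iff₀ (by linarith)] at this
    exact this
  have hp : 0 < 1 - a⁻¹ := by
    have := inv_lt_one_of_one_lt₀ ha1
    linarith
  have h6 : Real.log a ≤ N * Real.log (1 - a⁻¹)⁻¹ := by
    have h := Real.log_le_log (by positivity) h2
    rw [Real.log_one, Real.log_mul ha0.ne' (by positivity), Real.log_pow] at h
    rw [Real.log_inv]
    linarith
  have h7 : Real.log (1 - a⁻¹)⁻¹ ≤ 1 / (a - 1) := by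
    refine (Real.log_le_sub_one_of_pos (by positivity)).trans (le_of_eq ?_)
    have h8 : 1 - a⁻¹ = (a - 1) / a := by field_simp
    rw [h8, inv_div]
    field_simp
    ring
  have h9 : Real.log a * (a - 1) ≤ N := by
    have := h6.trans (mul_le_mul_of_nonneg_left h7 hN0)
    rw [mul_one_div, le_div_iff₀ ha2] at this
    exact this
  rw [abs_le]
  constructor <;> linarith

/-! ### Asymptotics of the solutions of `a log a ≈ n` -/

/-- The factor 2 leaves room for the shifted sequence `bellRatio (n + 1)`, still compared with `n`.
-/
theorem tendsto_atTop_of_mul_log {a : ℕ → ℝ} (ha : ∀ᶠ n in atTop, 1 < a n)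
    (h : ∀ᶠ n : ℕ in atTop, |(n : ℝ) - a n * Real.log (a n)| ≤ 2 * Real.log (a n)) :
    Tendsto a atTop atTop := by
  have hs : Tendsto (fun n : ℕ => Real.sqrt n - 2) atTop atTop :=
    tendsto_atTop_add_const_right _ _
      (Real.tendsto_sqrt_atTop.comp tendsto_natCast_atTop_atTop)
  refine tendsto_atTop_mono' _ ?_ hs
  filter_upwards [ha, h] with n h1 h2
  have h3 := (abs_le.1 h2).2
  have h4 : Real.log (a n) ≤ a n + 2 := by
    linarith [Real.log_le_sub_one_of_pos (show 0 < a n by linarith)]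
  have h5 : (n : ℝ) ≤ (a n + 2) ^ 2 := by
    have := mul_le_mul_of_nonneg_left h4 (show 0 ≤ a n + 2 by linarith)
    linarith
  have h6 := Real.sqrt_le_sqrt h5
  rw [Real.sqrt_sq (by linarith)] at h6
  linarith

/-- Write `l = log a` and `n = a l (1+θ)`, where `θ l → 0`. Then `log n = l + log l + log (1+θ)`, so
`a log n / n - 1 = (log l + log (1+θ) - θ l) / (l (1+θ))`, and `log l` dominates the numerator. -/
theorem tendsto_mul_log_div {a : ℕ → ℝ} (ha : ∀ᶠ n in atTop, 1 < a n)
    (h : ∀ᶠ n : ℕ in atTop, |(n : ℝ) - a n * Real.log (a n)| ≤ 2 * Real.log (a n)) :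
    Tendsto (fun n : ℕ => (a n * Real.log n / n - 1) * (Real.log n / Real.log (Real.log n)))
      atTop (𝓝 1) := by
  have hat := tendsto_atTop_of_mul_log ha h
  set l : ℕ → ℝ := fun n => Real.log (a n) with hl
  have hlt : Tendsto l atTop atTop := Real.tendsto_log_atTop.comp hat
  have hllt : Tendsto (fun n => Real.log (l n)) atTop atTop := Real.tendsto_log_atTop.comp hlt
  set θ : ℕ → ℝ := fun n => ((n : ℝ) - a n * l n) / (a n * l n) with hθ
  have hloglin : Tendsto (fun x : ℝ => Real.log x / x) atTop (𝓝 0) := by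
    simpa using Real.isLittleO_log_id_atTop.tendsto_div_nhds_zero
  have hθl : ∀ᶠ n in atTop, |θ n * l n| ≤ 2 * (Real.log (a n) / a n) := by
    filter_upwards [ha, h, hlt.eventually_gt_atTop 0] with n h1 h2 h3
    have ha0 : 0 < a n := by linarith
    have : θ n * l n = ((n : ℝ) - a n * l n) / a n := by
      simp only [hθ]
      field_simp
    rw [this, abs_div, abs_of_pos ha0, ← mul_div_assoc]
    exact div_le_div_of_nonneg_right h2 ha0.le
  have hθl0 : Tendsto (fun n => θ n * l n) atTop (𝓝 0) := by
    refine squeeze_zero_norm' hθl ?_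
    simpa using (hloglin.comp hat).const_mul 2
  have hθ0 : Tendsto θ atTop (𝓝 0) := by
    have := hθl0.mul hlt.inv_tendsto_atTop
    rw [zero_mul] at this
    refine this.congr' ?_
    filter_upwards [hlt.eventually_gt_atTop 0] with n h3
    simp only [Pi.inv_apply]
    field_simp
  have h1θ : Tendsto (fun n => 1 + θ n) atTop (𝓝 1) := by simpa using hθ0.const_add 1
  have hlogθ : Tendsto (fun n => Real.log (1 + θ n)) atTop (𝓝 0) := by
    simpa using h1θ.log one_ne_zero
  have hL : ∀ᶠ n : ℕ in atTop, Real.log n = l n + Real.log (l n) + Real.log (1 + θ n) := by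
    filter_upwards [ha, hlt.eventually_gt_atTop 0, h1θ.eventually (lt_mem_nhds zero_lt_one)]
      with n h1 h2 h3
    have ha0 : 0 < a n := by linarith
    have hn : (n : ℝ) = a n * l n * (1 + θ n) := by
      simp only [hθ]
      field_simp
      ring
    rw [hn, Real.log_mul (by positivity) h3.ne', Real.log_mul ha0.ne' h2.ne']
  have hLl : Tendsto (fun n : ℕ => Real.log n / l n) atTop (𝓝 1) := by
    have h1 : Tendsto (fun n => 1 + Real.log (l n) / l n + Real.log (1 + θ n) * (l n)⁻¹) atTop
        (𝓝 (1 + 0 + 0 * 0)) :=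
      ((hloglin.comp hlt).const_add 1).add (hlogθ.mul hlt.inv_tendsto_atTop)
    rw [mul_zero, add_zero, add_zero] at h1
    refine h1.congr' ?_
    filter_upwards [hL, hlt.eventually_gt_atTop 0] with n h1 h2
    rw [h1]
    field_simp
  have hLL : Tendsto (fun n : ℕ => Real.log (l n) / Real.log (Real.log n)) atTop (𝓝 1) := by
    have h1 : Tendsto (fun n : ℕ => (1 + Real.log (Real.log n / l n) * (Real.log (l n))⁻¹)⁻¹)
        atTop (𝓝 (1 + Real.log 1 * 0)⁻¹) :=
      (((hLl.log one_ne_zero).mul hllt.inv_tendsto_atTop).const_add 1).inv₀ (by simp)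
    rw [mul_zero, add_zero, inv_one] at h1
    refine h1.congr' ?_
    filter_upwards [hlt.eventually_gt_atTop 0, hllt.eventually_gt_atTop 0,
      (Real.tendsto_log_atTop.comp tendsto_natCast_atTop_atTop).eventually_gt_atTop 0]
      with n h1 h2 h3
    have h4 : (0 : ℝ) < Real.log n := h3
    rw [Real.log_div h4.ne' h1.ne']
    field_simp
    rw [add_sub_cancel]
  have hmain : Tendsto (fun n : ℕ => (1 + Real.log (1 + θ n) * (Real.log (l n))⁻¹ -
      θ n * l n * (Real.log (l n))⁻¹) * (Real.log n / l n) *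
      (Real.log (l n) / Real.log (Real.log n)) * (1 + θ n)⁻¹) atTop
      (𝓝 ((1 + 0 * 0 - 0 * 0) * 1 * 1 * 1⁻¹)) :=
    ((((((hlogθ.mul hllt.inv_tendsto_atTop).const_add 1).sub
      (hθl0.mul hllt.inv_tendsto_atTop)).mul hLl).mul hLL).mul (h1θ.inv₀ one_ne_zero))
  norm_num at hmain
  refine hmain.congr' ?_
  filter_upwards [hL, ha, hlt.eventually_gt_atTop 0, hllt.eventually_gt_atTop 0,
    h1θ.eventually (lt_mem_nhds zero_lt_one)] with n h1 h2 h3 h4 h5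
  have ha0 : 0 < a n := by linarith
  have hn : (n : ℝ) = a n * l n * (1 + θ n) := by
    simp only [hθ]
    field_simp
    ring
  have e1 : a n * Real.log n / n = Real.log n / l n * (1 + θ n)⁻¹ := by
    rw [div_eq_iff (by rw [hn]; positivity)]
    nth_rw 3 [hn]
    field_simp
  have e2 : Real.log n / l n - 1 - θ n =
      (1 + Real.log (1 + θ n) * (Real.log (l n))⁻¹ - θ n * l n * (Real.log (l n))⁻¹) *
        (Real.log (l n) / l n) := by
    rw [h1]
    field_simp
    ring
  have e3 : Real.log n / l n * (1 + θ n)⁻¹ - 1 =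
      (Real.log n / l n - 1 - θ n) * (1 + θ n)⁻¹ := by
    field_simp
    ring
  rw [e1, e3, e2]
  field_simp

/-! ### Asymptotics of Bell ratios and of the mean -/

theorem eventually_one_lt_bellRatio : ∀ᶠ n in atTop, 1 < bellRatio n := by
  filter_upwards [eventually_ge_atTop 2] with n hn
  obtain ⟨n, rfl⟩ := Nat.exists_eq_add_of_le' hn
  exact one_lt_bellRatio n

theorem eventually_abs_sub_bellRatio_mul_log_le : ∀ᶠ n : ℕ in atTop,
    |(n : ℝ) - bellRatio n * Real.log (bellRatio n)| ≤ Real.log (bellRatio n) := by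
  filter_upwards [eventually_ge_atTop 2] with n hn
  obtain ⟨n, rfl⟩ := Nat.exists_eq_add_of_le' hn
  exact abs_sub_bellRatio_mul_log_le n

theorem eventually_abs_sub_le_two_mul_log : ∀ᶠ n : ℕ in atTop,
    |(n : ℝ) - bellRatio n * Real.log (bellRatio n)| ≤ 2 * Real.log (bellRatio n) := by
  filter_upwards [eventually_abs_sub_bellRatio_mul_log_le] with n h
  linarith [(abs_nonneg _).trans h]

theorem tendsto_bellRatio : Tendsto bellRatio atTop atTop :=
  tendsto_atTop_of_mul_log eventually_one_lt_bellRatio eventually_abs_sub_le_two_mul_log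

theorem tendsto_bellRatio_mul_log_div :
    Tendsto (fun n : ℕ => (bellRatio n * Real.log n / n - 1) *
      (Real.log n / Real.log (Real.log n))) atTop (𝓝 1) :=
  tendsto_mul_log_div eventually_one_lt_bellRatio eventually_abs_sub_le_two_mul_log

theorem tendsto_bellRatio_succ_mul_log_div :
    Tendsto (fun n : ℕ => (bellRatio (n + 1) * Real.log n / n - 1) *
      (Real.log n / Real.log (Real.log n))) atTop (𝓝 1) := by
  refine tendsto_mul_log_div (a := fun n => bellRatio (n + 1))
    ((tendsto_add_atTop_nat 1).eventually eventually_one_lt_bellRatio) ?_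
  have h1 := (Real.tendsto_log_atTop.comp
    (tendsto_bellRatio.comp (tendsto_add_atTop_nat 1))).eventually_ge_atTop 1
  filter_upwards [h1,
    (tendsto_add_atTop_nat 1).eventually eventually_abs_sub_bellRatio_mul_log_le] with n h2 h3
  simp only [Function.comp_apply] at h2
  push_cast at h3
  rw [abs_le] at h3 ⊢
  constructor <;> linarith

theorem tendsto_log_natCast : Tendsto (fun n : ℕ => Real.log n) atTop atTop :=
  Real.tendsto_log_atTop.comp tendsto_natCast_atTop_atTop

theorem tendsto_loglog_natCast : Tendsto (fun n : ℕ => Real.log (Real.log n)) atTop atTop :=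
  Real.tendsto_log_atTop.comp tendsto_log_natCast

theorem tendsto_loglog_div_log :
    Tendsto (fun n : ℕ => Real.log (Real.log n) / Real.log n) atTop (𝓝 0) := by
  have h : Tendsto (fun x : ℝ => Real.log x / x) atTop (𝓝 0) := by
    simpa using Real.isLittleO_log_id_atTop.tendsto_div_nhds_zero
  exact h.comp tendsto_log_natCast

theorem tendsto_log_pow_div (k : ℕ) :
    Tendsto (fun n : ℕ => Real.log n ^ k / n) atTop (𝓝 0) := by
  have h : Tendsto (fun x : ℝ => Real.log x ^ k / x) atTop (𝓝 0) := by
    simpa using (Real.isLittleO_pow_log_id_atTop (n := k)).tendsto_div_nhds_zero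
  exact h.comp tendsto_natCast_atTop_atTop

theorem tendsto_bellRatio_mul_log_div_one :
    Tendsto (fun n : ℕ => bellRatio n * Real.log n / n) atTop (𝓝 1) := by
  have h := (tendsto_bellRatio_mul_log_div.mul tendsto_loglog_div_log).add_const 1
  rw [mul_zero, zero_add] at h
  refine h.congr' ?_
  filter_upwards [tendsto_log_natCast.eventually_gt_atTop 0,
    tendsto_loglog_natCast.eventually_gt_atTop 0] with n h1 h2
  field_simp
  ring

theorem tendsto_bellRatio_mul_bellRatio_succ :
    Tendsto (fun n : ℕ => (bellRatio n * bellRatio (n + 1) * (Real.log n / n) ^ 2 - 1) *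
      (Real.log n / Real.log (Real.log n))) atTop (𝓝 2) := by
  -- This is `(1+x)(1+y) - 1 = xy + (x + y)`, where `xy` is negligible and `x`, `y` contribute 1
  -- each.
  have h := (tendsto_bellRatio_mul_log_div.mul
    (tendsto_bellRatio_succ_mul_log_div.mul tendsto_loglog_div_log)).add
      (tendsto_bellRatio_mul_log_div.add tendsto_bellRatio_succ_mul_log_div)
  norm_num at h
  refine h.congr' ?_
  filter_upwards [tendsto_log_natCast.eventually_gt_atTop 0,
    tendsto_loglog_natCast.eventually_gt_atTop 0, eventually_gt_atTop 0] with n h1 h2 h3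
  have h4 : (0 : ℝ) < n := by exact_mod_cast h3
  field_simp
  ring

theorem tendsto_lower_order :
    Tendsto (fun n : ℕ => (3 / 4 * bellRatio n - ((n : ℝ) + 5 / 4) -
      (n : ℝ) / 2 * (bellRatio (n - 1))⁻¹) / n) atTop (𝓝 (-1)) := by
  have h1 := tendsto_bellRatio_mul_log_div_one.mul tendsto_log_natCast.inv_tendsto_atTop
  have h2 : Tendsto (fun n : ℕ => (bellRatio (n - 1))⁻¹) atTop (𝓝 0) :=
    (tendsto_bellRatio.comp (tendsto_sub_atTop_nat 1)).inv_tendsto_atTop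
  have h3 : Tendsto (fun n : ℕ => ((n : ℝ))⁻¹) atTop (𝓝 0) := tendsto_inv_atTop_nhds_zero_nat
  have h := (((h1.const_mul (3 / 4)).sub_const 1).sub (h3.const_mul (5 / 4))).sub
    (h2.const_mul (1 / 2))
  norm_num at h
  refine h.congr' ?_
  filter_upwards [tendsto_log_natCast.eventually_gt_atTop 0, eventually_gt_atTop 0] with n h1 h3
  have h4 : (0 : ℝ) < n := by exact_mod_cast h3
  have h5 := bellRatio_pos (n - 1)
  field_simp
  ring

theorem meanOverlappings_eq_bellRatio (n : ℕ) (hn : 1 ≤ n) :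
    meanOverlappings n = 1 / 4 * (bellRatio n * bellRatio (n + 1)) +
      (3 / 4 * bellRatio n - ((n : ℝ) + 5 / 4) - (n : ℝ) / 2 * (bellRatio (n - 1))⁻¹) := by
  rw [meanOverlappings_formula n hn]
  obtain ⟨n, rfl⟩ := Nat.exists_eq_add_of_le' hn
  have h1 := bell_pos n
  have h2 := bell_pos (n + 1)
  have h3 := bell_pos (n + 2)
  simp only [bellRatio, Nat.add_sub_cancel]
  field_simp
  ring

theorem tendsto_meanOverlappings :
    Tendsto (fun n : ℕ => (4 * meanOverlappings n * (Real.log n / n) ^ 2 - 1) *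
      (Real.log n / Real.log (Real.log n))) atTop (𝓝 2) := by
  have h := tendsto_bellRatio_mul_bellRatio_succ.add
    ((tendsto_lower_order.mul ((tendsto_log_pow_div 3).mul
      tendsto_loglog_natCast.inv_tendsto_atTop)).const_mul 4)
  norm_num at h
  refine h.congr' ?_
  filter_upwards [tendsto_loglog_natCast.eventually_gt_atTop 0, eventually_ge_atTop 1]
    with n h1 h2
  have h4 : (0 : ℝ) < n := by exact_mod_cast h2
  rw [meanOverlappings_eq_bellRatio n h2]
  field_simp
  ring

theorem meanOverlappings_asymptotics :
    ∃ ε : ℕ → ℝ, Tendsto ε atTop (𝓝 0) ∧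
      ∀ᶠ n : ℕ in atTop,
        meanOverlappings n =
          1 / 4 * ((n : ℝ) / Real.log n) ^ 2 *
            (1 + 2 * (Real.log (Real.log n) / Real.log n) * (1 + ε n)) := by
  -- This `ε` solves the required identity wherever the logarithms are positive.
  refine ⟨fun n => (4 * meanOverlappings n * (Real.log n / n) ^ 2 - 1) *
      (Real.log n / Real.log (Real.log n)) * (1 / 2) - 1, ?_, ?_⟩
  · have h := (tendsto_meanOverlappings.mul_const (1 / 2)).sub_const 1
    norm_num at h ⊢
    exact h
  · filter_upwards [tendsto_log_natCast.eventually_gt_atTop 0,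
      tendsto_loglog_natCast.eventually_gt_atTop 0, eventually_gt_atTop 0] with n h1 h2 h3
    have h4 : (0 : ℝ) < n := by exact_mod_cast h3
    field_simp
    ring

theorem theorem2p5 :
    -- exact mean over all partitions of `[n]`
    (∀ n : ℕ, 1 ≤ n →
      meanOverlappings n =
        1 / 4 * ((Nat.bell (n + 2) : ℝ) / (Nat.bell n : ℝ))
          + 3 / 4 * ((Nat.bell (n + 1) : ℝ) / (Nat.bell n : ℝ))
          - ((n : ℝ) + 5 / 4)
          - (n : ℝ) / 2 * ((Nat.bell (n - 1) : ℝ) / (Nat.bell n : ℝ))) ∧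
    -- its asymptotics, with `ε n` the `o(1)` term
    (∃ ε : ℕ → ℝ, Tendsto ε atTop (𝓝 0) ∧
      ∀ᶠ n : ℕ in atTop,
        meanOverlappings n =
          1 / 4 * ((n : ℝ) / Real.log n) ^ 2 *
            (1 + 2 * (Real.log (Real.log n) / Real.log n) * (1 + ε n))) ∧
    -- exact mean over the partitions of `[n]` into `k` blocks
    (∀ n k : ℕ, 1 ≤ k → k ≤ n →
      meanOverlappingsBlocks n k =
        1 / 2 * (Nat.choose k 2 : ℝ)
          + (n : ℝ) * ((k : ℝ) - 1) / 2 *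
              ((Nat.stirlingSecond (n - 1) (k - 1) : ℝ) / (Nat.stirlingSecond n k : ℝ))
          - 3 / 2 * ((n : ℝ) + 1 - (k : ℝ)) *
              ((Nat.stirlingSecond n (k - 1) : ℝ) / (Nat.stirlingSecond n k : ℝ))) ∧
    -- its asymptotics for a fixed number `k` of blocks
    (∀ k : ℕ, 1 ≤ k →
      Tendsto (fun n : ℕ => meanOverlappingsBlocks n k - 1 / 2 * (Nat.choose k 2 : ℝ))
        atTop (𝓝 0)) := by
  exact ⟨meanOverlappings_formula, meanOverlappings_asymptotics,
    meanOverlappingsBlocks_formula, tendsto_meanOverlappingsBlocks⟩
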